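/- Let $(X,\mathcal E)$ and $(Y,\mathcal F)$ be uniformly locally finite coarse spaces, i.e. $\sup_{x\in X}|\{x' : (x,x')\in E\}|<\infty$ for every $E\in\mathcal E$, and likewise for $\mathcal F$. Suppose that both admit small partitions and that the uniform Roe algebras $\mathrm C^*_u(X)$ and $\mathrm C^*_u(Y)$ are rigidly isomorphic. Then $(X,\mathcal E)$ and $(Y,\mathcal F)$ are coarsely equivalent. Here the terms are defined as follows. (1) Let $\mathbb D=\{z\in\mathbb C:|z|\le 1\}$. For a set $J$, let $\mathrm{cov}(\mathbb D^J)$ be the least cardinality of a family of nowhere dense subsets of $\mathbb D^J$ (product topology) that covers $\mathbb D^J$ ($\infty$ if there is none, i.e. if $J=\emptyset$). A coarse space $(X,\mathcal E)$ is small if $\mathrm{cov}(\mathbb D^X)>|\mathcal E|_{\min}$, where $|\mathcal E|_{\min}$ is the least cardinality of a set of generators of $\mathcal E$ (the coarse structure generated by a family of subsets of $X\times X$ is the intersection of all coarse structures on $X$ containing it). (2) $(X,\mathcal E)$ admits a small partition if there is a partition $X=\bigsqcup_{i\in I}X_i$ such that, with $\mathcal E_\Delta=\{E\cap\bigsqcup_{i}(X_i\times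 X_i) : E\in\mathcal E\}$, the coarse space $(X,\mathcal E_\Delta)$ is small and $\mathcal E$ is generated by $\mathcal E_\Delta\cup\{E\in\mathcal E : |E|<\infty\}$. (3) $\mathrm C^*_u(X)$ is the norm closure in $B(\ell_2(X))$ of the algebra of all $T\in B(\ell_2(X))$ for which there is $E\in\mathcal E$ with $\langle T\delta_x,\delta_{x'}\rangle=0$ for all $(x,x')\notin E$. The algebras $\mathrm C^*_u(X)$ and $\mathrm C^*_u(Y)$ are rigidly isomorphic if there are a $*$-isomorphism $\Phi:\mathrm C^*_u(X)\to\mathrm C^*_u(Y)$ and a unitary $U:\ell_2(X)\to\ell_2(Y)$ with $\Phi(T)=UTU^*$ for all $T$, such that $$\inf_{x\in X}\sup_{y\in Y}|\langle U\delta_x,\delta_y\rangle|>0\quad\text{and}\quad \inf_{y\in Y}\sup_{x\in X}|\langle U^*\delta_y,\delta_x\rangle|>0 ,$$ where infima and suprema are taken in $[0,\infty]$. (4) A map $f:X\to Y$ is coarse if for every $E\in\mathcal E$ there is $F\in\mathcal F$ such that $(x,x')\in E$ implies $(f(x),f(x'))\in F$. The spaces are coarsely equivalent if there are coarse maps $f:X\to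 Y$ and $g:Y\to X$ such that for every $F\in\mathcal F$ there is $E\in\mathcal E$ for which $(x,x')\notin E$ implies $(f(x),f(x'))\notin F$, and such that $\{(g(f(x)),x):x\in X\}\in\mathcal E$ and $\{(f(g(y)),y):y\in Y\}\in\mathcal F$. -/

import Mathlib

open scoped SetRel ENNReal

universe u v

/-- A coarse structure on a set `X`. Composition is
`E ○ F = {(x, y) | ∃ z, (x, z) ∈ E ∧ (z, y) ∈ F}` and `E.inv = {(x, y) | (y, x) ∈ E}`. -/
@[ext]
structure CoarseStructure (X : Type u) where
  /-- the collection of entourages -/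
  entourages : Set (SetRel X X)
  diag_mem : {p : X × X | p.1 = p.2} ∈ entourages
  subset_mem : ∀ E F : SetRel X X, E ∈ entourages → F ⊆ E → F ∈ entourages
  inv_mem : ∀ E : SetRel X X, E ∈ entourages → E.inv ∈ entourages
  union_mem : ∀ E F : SetRel X X, E ∈ entourages → F ∈ entourages → E ∪ F ∈ entourages
  comp_mem : ∀ E F : SetRel X X, E ∈ entourages → F ∈ entourages → E ○ F ∈ entourages

namespace CoarseStructure

variable {X : Type u} {Y : Type v}

/-- The coarse structure generated by a family `G` of subsets of `X × X`: the intersection of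
all coarse structures on `X` that contain `G`. -/
def generate (G : Set (SetRel X X)) : CoarseStructure X where
  entourages := {E | ∀ 𝓔 : CoarseStructure X, G ⊆ 𝓔.entourages → E ∈ 𝓔.entourages}
  diag_mem := fun 𝓔 _ => 𝓔.diag_mem
  subset_mem := fun E F hE hFE 𝓔 h => 𝓔.subset_mem E F (hE 𝓔 h) hFE
  inv_mem := fun E hE 𝓔 h => 𝓔.inv_mem E (hE 𝓔 h)
  union_mem := fun E F hE hF 𝓔 h => 𝓔.union_mem E F (hE 𝓔 h) (hF 𝓔 h)
  comp_mem := fun E F hE hF 𝓔 h => 𝓔.comp_mem E F (hE 𝓔 h) (hF 𝓔 h)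

/-- `X` is uniformly locally finite: `sup_x |E_x| < ∞` for every entourage `E`, where
`E_x = {y | (x, y) ∈ E}`. -/
def UniformlyLocallyFinite (𝓔 : CoarseStructure X) : Prop :=
  ∀ E ∈ 𝓔.entourages, ⨆ x : X, {y : X | (x, y) ∈ E}.encard < ⊤

/-- The minimal cardinality of a set of generators of a coarse structure. -/
noncomputable def minGenerators (𝓔 : CoarseStructure X) : Cardinal.{u} :=
  sInf {κ | ∃ G : Set (SetRel X X), generate G = 𝓔 ∧ Cardinal.mk G = κ}

end CoarseStructure

/-- `cov(𝔻^J)`: the minimal cardinality of a family of nowhere dense subsets of `𝔻^J` that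
covers `𝔻^J`, where `𝔻` is the closed unit disc in `ℂ` and `𝔻^J` has the product topology.
The value is `⊤` if there is no such family, which happens only for empty `J`. -/
noncomputable def covDisc (J : Type u) : WithTop Cardinal.{u} :=
  ⨅ (𝒰 : Set (Set (J → Metric.closedBall (0 : ℂ) 1)))
    (_ : (∀ A ∈ 𝒰, IsNowhereDense A) ∧ ⋃₀ 𝒰 = Set.univ), ((Cardinal.mk 𝒰 : Cardinal.{u}) : WithTop Cardinal.{u})

namespace CoarseStructure

variable {X : Type u} {Y : Type v}

/-- A coarse space is small if `cov(𝔻^X)` exceeds the minimal number of generators. -/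
def IsSmall (𝓔 : CoarseStructure X) : Prop :=
  (𝓔.minGenerators : WithTop Cardinal.{u}) < covDisc X

/-- For a partition of `X`, given as an equivalence relation `r` whose classes are the blocks
`X_i`, the coarse structure `{E ∩ ⋃_i (X_i × X_i) | E ∈ 𝓔}`. -/
def blockDiagonal (𝓔 : CoarseStructure X) (r : Setoid X) : CoarseStructure X where
  entourages := {D | ∃ E ∈ 𝓔.entourages, D = {p : X × X | r p.1 p.2} ∩ E}
  diag_mem := by
    refine ⟨_, 𝓔.diag_mem, ?_⟩
    ext ⟨x, y⟩
    simp only [Set.mem_inter_iff, Set.mem_ofPred_eq]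
    exact ⟨fun h => ⟨h ▸ r.refl x, h⟩, fun h => h.2⟩
  subset_mem := by
    rintro _ F ⟨E, hE, rfl⟩ hF
    exact ⟨F, 𝓔.subset_mem E F hE (hF.trans Set.inter_subset_right),
      (Set.inter_eq_self_of_subset_right (hF.trans Set.inter_subset_left)).symm⟩
  inv_mem := by
    rintro _ ⟨E, hE, rfl⟩
    refine ⟨_, 𝓔.inv_mem E hE, ?_⟩
    ext ⟨x, y⟩
    exact ⟨fun h => ⟨r.symm h.1, h.2⟩, fun h => ⟨r.symm h.1, h.2⟩⟩
  union_mem := by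
    rintro _ _ ⟨E, hE, rfl⟩ ⟨F, hF, rfl⟩
    exact ⟨_, 𝓔.union_mem E F hE hF, (Set.inter_union_distrib_left _ _ _).symm⟩
  comp_mem := by
    rintro _ _ ⟨E, hE, rfl⟩ ⟨F, hF, rfl⟩
    refine ⟨_, 𝓔.subset_mem _ _ (𝓔.comp_mem E F hE hF) ?_,
      (Set.inter_eq_self_of_subset_right ?_).symm⟩
    · rintro ⟨x, y⟩ ⟨z, h₁, h₂⟩
      exact ⟨z, h₁.2, h₂.2⟩
    · rintro ⟨x, y⟩ ⟨z, h₁, h₂⟩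
      exact r.trans h₁.1 h₂.1

/-- A coarse space admits a small partition if for some partition of `X` the block-diagonal
structure is small and, together with the finite entourages, generates the coarse structure. -/
def AdmitsSmallPartition (𝓔 : CoarseStructure X) : Prop :=
  ∃ r : Setoid X, (𝓔.blockDiagonal r).IsSmall ∧
    generate ((𝓔.blockDiagonal r).entourages ∪ {E | E ∈ 𝓔.entourages ∧ E.Finite}) = 𝓔

/-- Two maps into a coarse space are close. -/
def Close {Z : Type*} (𝓔 : CoarseStructure X) (f g : Z → X) : Prop :=
  {p : X × X | ∃ z : Z, p = (f z, g z)} ∈ 𝓔.entourages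

/-- Coarse maps. -/
def IsCoarse (𝓔 : CoarseStructure X) (𝓕 : CoarseStructure Y) (f : X → Y) : Prop :=
  ∀ E ∈ 𝓔.entourages, ∃ F ∈ 𝓕.entourages, ∀ x x' : X, (x, x') ∈ E → (f x, f x') ∈ F

/-- Coarse embeddings. -/
def IsCoarseEmbedding (𝓔 : CoarseStructure X) (𝓕 : CoarseStructure Y) (f : X → Y) : Prop :=
  IsCoarse 𝓔 𝓕 f ∧
    ∀ F ∈ 𝓕.entourages, ∃ E ∈ 𝓔.entourages, ∀ x x' : X, (x, x') ∉ E → (f x, f x') ∉ F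

/-- Coarse equivalences. -/
def IsCoarseEquivalence (𝓔 : CoarseStructure X) (𝓕 : CoarseStructure Y) (f : X → Y) : Prop :=
  IsCoarseEmbedding 𝓔 𝓕 f ∧
    ∃ g : Y → X, IsCoarse 𝓕 𝓔 g ∧ Close 𝓔 (g ∘ f) id ∧ Close 𝓕 (f ∘ g) id

/-- Two coarse spaces are coarsely equivalent. -/
def CoarselyEquivalent (𝓔 : CoarseStructure X) (𝓕 : CoarseStructure Y) : Prop :=
  ∃ f : X → Y, IsCoarseEquivalence 𝓔 𝓕 f

end CoarseStructure

/-- The complex Hilbert space `ℓ₂(X)`. -/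
abbrev EllTwo (X : Type u) : Type u := lp (fun _ : X => ℂ) 2

open Classical in
/-- The standard basis vector `δ_x` of `ℓ₂(X)`. -/
noncomputable def delta {X : Type u} (x : X) : EllTwo X := lp.single 2 x (1 : ℂ)

theorem inner_delta_left {X : Type u} (x : X) (ξ : EllTwo X) : inner ℂ (delta x) ξ = ξ x := by
  classical
  have h := lp.inner_single_left (𝕜 := ℂ) (G := fun _ : X => ℂ) x (1 : ℂ) ξ
  unfold delta
  convert h using 1
  simp

namespace CoarseStructure

variable {X : Type u} {Y : Type v}

/-- The algebraic uniform Roe algebra: bounded operators `T` on `ℓ₂(X)` for which there is an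
entourage `E` such that `⟨T δ_x, δ_{x'}⟩ = 0` whenever `(x, x') ∉ E`. -/
noncomputable def algRoe (𝓔 : CoarseStructure X) :
    StarSubalgebra ℂ (EllTwo X →L[ℂ] EllTwo X) where
  carrier := {T | ∃ E ∈ 𝓔.entourages, ∀ x x' : X, (x, x') ∉ E →
    inner ℂ (T (delta x)) (delta x') = 0}
  mul_mem' := by
    rintro S T ⟨E, hE, hS⟩ ⟨F, hF, hT⟩
    refine ⟨F ○ E, 𝓔.comp_mem F E hF hE, fun x x' hx => ?_⟩
    have h : (inner ℂ ((S * T) (delta x)) (delta x') : ℂ)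
        = inner ℂ (T (delta x)) (ContinuousLinearMap.adjoint S (delta x')) := by
      rw [ContinuousLinearMap.adjoint_inner_right]
      rfl
    rw [h, lp.inner_eq_tsum]
    refine (tsum_congr fun z => ?_).trans tsum_zero
    by_cases hz : (x, z) ∈ F
    · have hz' : (z, x') ∉ E := fun h' => hx ⟨z, hz, h'⟩
      have h0 := hS z x' hz'
      rw [← ContinuousLinearMap.adjoint_inner_right, inner_delta_left] at h0
      rw [h0, inner_zero_right]
    · have h0 := hT x z hz
      rw [← inner_conj_symm, inner_delta_left, map_eq_zero] at h0
      rw [h0, inner_zero_left]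
  add_mem' := by
    rintro S T ⟨E, hE, hS⟩ ⟨F, hF, hT⟩
    refine ⟨E ∪ F, 𝓔.union_mem E F hE hF, fun x x' hx => ?_⟩
    rw [add_apply, inner_add_left, hS x x' fun h => hx (Or.inl h),
      hT x x' fun h => hx (Or.inr h), add_zero]
  algebraMap_mem' := by
    intro c
    refine ⟨_, 𝓔.diag_mem, fun x x' hx => ?_⟩
    have hne : x ≠ x' := hx
    rw [Algebra.algebraMap_eq_smul_one]
    change inner ℂ (c • delta x) (delta x') = 0
    rw [inner_smul_left, inner_delta_left]
    simp [delta, lp.single_apply, hne]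
  star_mem' := by
    rintro T ⟨E, hE, hT⟩
    refine ⟨E.inv, 𝓔.inv_mem E hE, fun x x' hx => ?_⟩
    rw [ContinuousLinearMap.star_eq_adjoint, ContinuousLinearMap.adjoint_inner_left,
      ← inner_conj_symm, hT x' x hx, map_zero]

/-- The uniform Roe algebra `C*_u(X)`: the norm closure of the algebraic uniform Roe algebra. -/
noncomputable def uniformRoe (𝓔 : CoarseStructure X) :
    StarSubalgebra ℂ (EllTwo X →L[ℂ] EllTwo X) :=
  𝓔.algRoe.topologicalClosure

/-- `C*_u(X)` and `C*_u(Y)` are rigidly isomorphic: there is a `*`-isomorphism `Φ` between them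
which has the form `Φ(T) = U T U*` for a unitary `U : ℓ₂(X) → ℓ₂(Y)` such that
`inf_x sup_y |⟨U δ_x, δ_y⟩| > 0` and `inf_y sup_x |⟨U* δ_y, δ_x⟩| > 0`. The infima and suprema
are taken in `[0, ∞]`. -/
def RigidlyIsomorphic (𝓔 : CoarseStructure X) (𝓕 : CoarseStructure Y) : Prop :=
  ∃ (Φ : 𝓔.uniformRoe ≃⋆ₐ[ℂ] 𝓕.uniformRoe) (U : EllTwo X ≃ₗᵢ[ℂ] EllTwo Y),
    (∀ (T : 𝓔.uniformRoe) (η : EllTwo Y),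
      (Φ T : EllTwo Y →L[ℂ] EllTwo Y) η
        = U ((T : EllTwo X →L[ℂ] EllTwo X) (U.symm η))) ∧
    0 < ⨅ x : X, ⨆ y : Y, ‖(inner ℂ (U (delta x)) (delta y) : ℂ)‖ₑ ∧
    0 < ⨅ y : Y, ⨆ x : X, ‖(inner ℂ (U.symm (delta y)) (delta x) : ℂ)‖ₑ

end CoarseStructure

/-! Put `b y = U* δ_y`. For an entourage `E` of `X`, call `y, y'` related if `|b y x| |b y' x'| ≥ δ`
for some `(x, x') ∈ E`; this is `transport b δ E`. The core claim is that this relation is an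
entourage of `Y` (`transport_mem`). Rigidity provides `f` and `g` that pick uniformly large entries
of `U` and `U*`, and with the claim in both directions every condition for a coarse equivalence
becomes a product of two such entries.

For the claim, uniform local finiteness splits `E` into finitely many graphs `x = φ x'`. Along one
graph, the weighted operators `S_μ η x = μ (h x) η (φ x)` lie in the Roe algebra of `X`, so each
conjugate `U S_μ U*` has small entries off some entourage of `Y`, which depends on `μ`. That
entourage is block-diagonal up to finitely many pairs, hence inside one of at most `max(ℵ₀, κ)`
words in `κ` generators of the block-diagonal structure, up to a finite set. Since `κ < cov(𝔻^Y)`, a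
category argument (`exists_isOpen_forall_norm_le`) makes the word and the finite set uniform over a
nonempty open set of weights. Such a set leaves all but finitely many coordinates free. Moving one
free coordinate from `1` to `-1` isolates one product `b y (φ x) · b y' x`, up to conjugation, which
must therefore be small off the word and the finite set (`transport_graph_mem`).

The weights live in `𝔻^Y`, since smallness concerns `Y`, while the operators act on `ℓ₂(X)`; the
injection `h : X → Y` joins the two when `X` is infinite. -/

open Topology Set Filter

namespace CoarseStructure

variable {X : Type u} {Y : Type v}

/-! ### Entourages of a generated coarse structure -/

/-- The symmetric reflexive relation spanned by `g`. -/
def symmHull (g : SetRel X X) : SetRel X X := {p | p.1 = p.2 ∨ p ∈ g ∨ (p.2, p.1) ∈ g}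

/-- The composition of the symmetric reflexive hulls of a list of relations. -/
def word : List (SetRel X X) → SetRel X X
  | [] => {p | p.1 = p.2}
  | g :: l => symmHull g ○ word l

theorem symmHull_mem (𝓔 : CoarseStructure X) {g : SetRel X X} (hg : g ∈ 𝓔.entourages) :
    symmHull g ∈ 𝓔.entourages := by
  refine 𝓔.subset_mem _ _ (𝓔.union_mem _ _ 𝓔.diag_mem (𝓔.union_mem _ _ hg (𝓔.inv_mem _ hg))) ?_
  rintro ⟨x, y⟩ (h | h | h)
  exacts [Or.inl h, Or.inr (Or.inl h), Or.inr (Or.inr h)]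

theorem word_mem (𝓔 : CoarseStructure X) :
    ∀ l : List (SetRel X X), (∀ g ∈ l, g ∈ 𝓔.entourages) → word l ∈ 𝓔.entourages
  | [], _ => 𝓔.diag_mem
  | g :: l, h => 𝓔.comp_mem _ _ (𝓔.symmHull_mem (h g (by simp)))
      (word_mem 𝓔 l fun g' hg' => h g' (by simp [hg']))

theorem word_refl (l : List (SetRel X X)) (x : X) : (x, x) ∈ word l := by
  induction l with
  | nil => exact rfl
  | cons g l ih => exact ⟨x, Or.inl rfl, ih⟩

theorem word_append {l m : List (SetRel X X)} {x y z : X} (h₁ : (x, y) ∈ word l)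
    (h₂ : (y, z) ∈ word m) : (x, z) ∈ word (l ++ m) := by
  induction l generalizing x with
  | nil => have : x = y := h₁; exact this ▸ h₂
  | cons g l ih =>
    obtain ⟨w, hw, hw'⟩ := h₁
    exact ⟨w, hw, ih hw'⟩

theorem word_reverse {l : List (SetRel X X)} {x y : X} (h : (x, y) ∈ word l) :
    (y, x) ∈ word l.reverse := by
  induction l generalizing x with
  | nil => exact Eq.symm h
  | cons g l ih =>
    obtain ⟨w, hw, hw'⟩ := h
    rw [List.reverse_cons]
    refine word_append (ih hw') ⟨x, ?_, rfl⟩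
    rcases hw with h | h | h
    exacts [Or.inl h.symm, Or.inr (Or.inr h), Or.inr (Or.inl h)]

/-- The subsets of words form a coarse structure containing `G`. Indexing by lists bounds the size
of a cofinal family of entourages by `max(ℵ₀, |G|)`, the count needed for the category argument. -/
theorem exists_subset_word {G : Set (SetRel X X)} {E : SetRel X X}
    (hE : E ∈ (generate G).entourages) : ∃ l : List G, E ⊆ word (l.map Subtype.val) := by
  let 𝓦 : CoarseStructure X :=
    { entourages := {E | ∃ l : List G, E ⊆ word (l.map Subtype.val)}
      diag_mem := ⟨[], fun _ h => h⟩
      subset_mem := fun E F ⟨l, hl⟩ h => ⟨l, h.trans hl⟩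
      inv_mem := by
        rintro E ⟨l, hl⟩
        refine ⟨l.reverse, ?_⟩
        rintro ⟨x, y⟩ h
        rw [List.map_reverse]
        exact word_reverse (hl h)
      -- Words are reflexive, so a concatenation contains both of its factors.
      union_mem := by
        rintro E F ⟨l, hl⟩ ⟨m, hm⟩
        refine ⟨l ++ m, ?_⟩
        rintro ⟨x, y⟩ (h | h) <;> rw [List.map_append]
        · exact word_append (hl h) (word_refl _ y)
        · exact word_append (word_refl _ x) (hm h)
      comp_mem := by
        rintro E F ⟨l, hl⟩ ⟨m, hm⟩
        refine ⟨l ++ m, ?_⟩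
        rintro ⟨x, y⟩ ⟨z, h₁, h₂⟩
        rw [List.map_append]
        exact word_append (hl h₁) (hm h₂) }
  refine hE 𝓦 fun g hg => ⟨[⟨g, hg⟩], ?_⟩
  rintro ⟨x, y⟩ h
  exact ⟨y, Or.inr (Or.inl h), rfl⟩

theorem subset_generate (G : Set (SetRel X X)) : G ⊆ (generate G).entourages :=
  fun _ hg _ h => h hg

theorem exists_generate_eq_mk_eq_minGenerators (𝓔 : CoarseStructure X) :
    ∃ G : Set (SetRel X X), generate G = 𝓔 ∧ Cardinal.mk G = 𝓔.minGenerators := by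
  refine csInf_mem (s := {κ | ∃ G : Set (SetRel X X), generate G = 𝓔 ∧ Cardinal.mk G = κ})
    ⟨_, 𝓔.entourages, ?_, rfl⟩
  ext E
  exact ⟨fun h => h 𝓔 subset_rfl, fun h => subset_generate _ h⟩

/-- Coarse structures need not be connected, so finiteness alone is not enough and each pair has to
be controlled separately. -/
theorem finite_mem (𝓔 : CoarseStructure X) {K : SetRel X X} (hK : K.Finite)
    (h : ∀ p ∈ K, ∃ E ∈ 𝓔.entourages, p ∈ E) : K ∈ 𝓔.entourages := by
  induction K, hK using Set.Finite.induction_on with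
  | empty => exact 𝓔.subset_mem _ _ 𝓔.diag_mem (empty_subset _)
  | @insert p K _ _ ih =>
    obtain ⟨E, hE, hp⟩ := h p (mem_insert _ _)
    refine 𝓔.subset_mem _ _
      (𝓔.union_mem _ _ hE (ih fun q hq => h q (mem_insert_of_mem _ hq))) ?_
    rintro q (rfl | hq)
    exacts [Or.inl hp, Or.inr hq]

theorem UniformlyLocallyFinite.exists_bound {𝓔 : CoarseStructure X}
    (h𝓔 : 𝓔.UniformlyLocallyFinite) {E : SetRel X X} (hE : E ∈ 𝓔.entourages) :
    ∃ N : ℕ, ∀ x, {y | (x, y) ∈ E}.encard ≤ N := by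
  obtain ⟨N, hN⟩ := ENat.ne_top_iff_exists.mp (h𝓔 E hE).ne
  exact ⟨N, fun x => hN ▸ le_iSup (fun x => {y | (x, y) ∈ E}.encard) x⟩

theorem UniformlyLocallyFinite.finite_section {𝓔 : CoarseStructure X}
    (h𝓔 : 𝓔.UniformlyLocallyFinite) {E : SetRel X X} (hE : E ∈ 𝓔.entourages) (x : X) :
    {y | (x, y) ∈ E}.Finite := by
  obtain ⟨N, hN⟩ := h𝓔.exists_bound hE
  exact finite_of_encard_le_coe (hN x)

theorem mem_of_mem_blockDiagonal {𝓔 : CoarseStructure X} {r : Setoid X} {E : SetRel X X}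
    (hE : E ∈ (𝓔.blockDiagonal r).entourages) : E ∈ 𝓔.entourages := by
  obtain ⟨E', hE', rfl⟩ := hE
  exact 𝓔.subset_mem _ _ hE' inter_subset_right

/-- Entourages of a structure generated by block-diagonal and finite ones are block-diagonal up
to finitely many points. -/
theorem exists_blockDiagonal_finite_diff {𝓔 : CoarseStructure X}
    (h𝓔 : 𝓔.UniformlyLocallyFinite) {r : Setoid X}
    (hr : generate ((𝓔.blockDiagonal r).entourages ∪ {E | E ∈ 𝓔.entourages ∧ E.Finite}) = 𝓔)
    {E : SetRel X X} (hE : E ∈ 𝓔.entourages) :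
    ∃ D ∈ (𝓔.blockDiagonal r).entourages, (E \ D).Finite := by
  let 𝓑 := 𝓔.blockDiagonal r
  have hfin : ∀ D ∈ 𝓑.entourages, ∀ x, {y | (x, y) ∈ D}.Finite := fun D hD x =>
    h𝓔.finite_section (mem_of_mem_blockDiagonal hD) x
  have hfin' : ∀ D ∈ 𝓑.entourages, ∀ x, {y | (y, x) ∈ D}.Finite := fun D hD x =>
    hfin _ (𝓑.inv_mem D hD) x
  let 𝓦 : CoarseStructure X :=
    { entourages := {E | ∃ D ∈ 𝓑.entourages, (E \ D).Finite}
      diag_mem := ⟨_, 𝓑.diag_mem, by simp⟩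
      subset_mem := fun E F ⟨D, hD, hf⟩ h => ⟨D, hD, hf.subset (sdiff_subset_sdiff_left h)⟩
      inv_mem := by
        rintro E ⟨D, hD, hf⟩
        refine ⟨_, 𝓑.inv_mem D hD, (hf.image Prod.swap).subset ?_⟩
        rintro ⟨x, y⟩ ⟨h₁, h₂⟩
        exact ⟨(y, x), ⟨h₁, h₂⟩, rfl⟩
      union_mem := by
        rintro E F ⟨D, hD, hf⟩ ⟨D', hD', hf'⟩
        refine ⟨_, 𝓑.union_mem _ _ hD hD', (hf.union hf').subset ?_⟩
        rintro p ⟨h₁ | h₁, h₂⟩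
        · exact Or.inl ⟨h₁, fun h => h₂ (Or.inl h)⟩
        · exact Or.inr ⟨h₁, fun h => h₂ (Or.inr h)⟩
      comp_mem := by
        rintro E F ⟨D, hD, hf⟩ ⟨D', hD', hf'⟩
        refine ⟨_, 𝓑.comp_mem _ _ hD hD', ?_⟩
        -- A pair of `E ○ F` outside `D ○ D'` uses a leg in `E \ D` or in `F \ D'`. Finite sections
        -- of `D` and `D'` leave finitely many possibilities for the other leg.
        have h₁ : (⋃ p ∈ E \ D, (fun y => (p.1, y)) ''
            ({y | (p.2, y) ∈ D'} ∪ Prod.snd '' (F \ D'))).Finite :=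
          hf.biUnion fun p _ => ((hfin _ hD' _).union (hf'.image _)).image _
        have h₂ : (⋃ p ∈ F \ D', (fun x => (x, p.2)) '' {x | (x, p.1) ∈ D}).Finite :=
          hf'.biUnion fun p _ => (hfin' _ hD _).image _
        refine (h₁.union h₂).subset ?_
        rintro ⟨x, y⟩ ⟨⟨z, hxz, hzy⟩, hn⟩
        by_cases hxz' : (x, z) ∈ D
        · have hzy' : (z, y) ∉ D' := fun h => hn ⟨z, hxz', h⟩
          exact Or.inr (mem_biUnion (x := (z, y)) ⟨hzy, hzy'⟩ ⟨x, hxz', rfl⟩)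
        · refine Or.inl (mem_biUnion (x := (x, z)) ⟨hxz, hxz'⟩ ⟨y, ?_, rfl⟩)
          by_cases hzy' : (z, y) ∈ D'
          · exact Or.inl hzy'
          · exact Or.inr ⟨(z, y), ⟨hzy, hzy'⟩, rfl⟩ }
  rw [← hr] at hE
  refine hE 𝓦 ?_
  rintro F (hF | ⟨-, hF⟩)
  · exact ⟨F, hF, by simp⟩
  · exact ⟨_, 𝓑.diag_mem, hF.subset sdiff_subset⟩

/-- Every relation with finitely bounded sections is covered by finitely many choice functions. -/
theorem exists_selections {E : SetRel X X} (hrefl : ∀ x, (x, x) ∈ E) {N : ℕ}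
    (hN : ∀ x, {y | (x, y) ∈ E}.encard ≤ N) :
    ∃ φ : Fin N → X → X, (∀ i x, (x, φ i x) ∈ E) ∧ ∀ x y, (x, y) ∈ E → ∃ i, φ i x = y := by
  have key : ∀ x, ∃ φ : Fin N → X, (∀ i, (x, φ i) ∈ E) ∧ ∀ y, (x, y) ∈ E → ∃ i, φ i = y := by
    intro x
    have hfin : {y | (x, y) ∈ E}.Finite := finite_of_encard_le_coe (hN x)
    have : Fintype {y | (x, y) ∈ E} := hfin.fintype
    -- Sections may have fewer than `N` points; reflexivity supplies a value for the superfluous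
    -- indices.
    have : Nonempty {y | (x, y) ∈ E} := ⟨⟨x, hrefl x⟩⟩
    have hcard : Fintype.card {y | (x, y) ∈ E} ≤ Fintype.card (Fin N) := by
      have h := hN x
      rw [encard_eq_coe_toFinset_card, toFinset_card] at h
      rw [Fintype.card_fin]
      exact_mod_cast h
    obtain ⟨e⟩ := Function.Embedding.nonempty_of_card_le hcard
    refine ⟨fun i => (Function.invFun e i).1, fun i => (Function.invFun e i).2, fun y hy => ?_⟩
    exact ⟨e ⟨y, hy⟩, by simp only [Function.leftInverse_invFun e.injective _]⟩
  choose φ h₁ h₂ using key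
  exact ⟨fun i x => φ x i, fun i x => h₁ x i, fun x y h => h₂ x y h⟩

end CoarseStructure

/-! ### Category arguments in `𝔻^J` -/

theorem exists_nonempty_interior_of_lt_covDisc {J : Type v} {κ : Cardinal.{v}}
    (hκ : (κ : WithTop Cardinal.{v}) < covDisc J) {ι : Type v} (hι : Cardinal.mk ι ≤ max Cardinal.aleph0 κ)
    (A : ι → Set (J → Metric.closedBall (0 : ℂ) 1)) (hA : ∀ i, IsClosed (A i))
    (hcov : ⋃ i, A i = univ) : ∃ i, (interior (A i)).Nonempty := by
  by_cases hc : Cardinal.mk ι ≤ Cardinal.aleph0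
  -- Here `κ` may be finite while `ι` is infinite, so the bound on `covDisc J` does not suffice;
  -- Baire's theorem in the compact space `𝔻^J` replaces it.
  · have : Countable ι := Cardinal.mk_le_aleph0_iff.mp hc
    have : Nonempty (J → Metric.closedBall (0 : ℂ) 1) := ⟨fun _ => ⟨0, by simp⟩⟩
    have : CompactSpace (Metric.closedBall (0 : ℂ) 1) :=
      isCompact_iff_compactSpace.mp (isCompact_closedBall 0 1)
    exact nonempty_interior_of_iUnion_of_closed hA hcov
  · by_contra! hne
    have hle : covDisc J ≤ ((Cardinal.mk (range A) : Cardinal.{v}) : WithTop Cardinal.{v}) := by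
      refine iInf₂_le (range A) ⟨?_, ?_⟩
      · rintro _ ⟨i, rfl⟩
        exact (hA i).isNowhereDense_iff.mpr (hne i)
      · rw [sUnion_range, hcov]
    have hκ' : Cardinal.mk ι ≤ κ := by
      rcases le_max_iff.mp hι with h | h
      exacts [absurd h hc, h]
    have : Cardinal.mk (range A) ≤ κ := Cardinal.mk_range_le.trans hκ'
    exact absurd hκ (not_lt.mpr (hle.trans (WithTop.coe_le_coe.mpr this)))

/-- If for every `μ` all but finitely many of the values `e μ p` with `p` outside one of the sets
`P i` are small, then for `μ` in some nonempty open set this happens uniformly. -/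
theorem exists_isOpen_forall_norm_le {J : Type v} {κ : Cardinal.{v}}
    (hκ : (κ : WithTop Cardinal.{v}) < covDisc J) {ι : Type v} (hι : Cardinal.mk ι ≤ max Cardinal.aleph0 κ)
    {Q : Type*} (P : ι → Set Q) (e : (J → Metric.closedBall (0 : ℂ) 1) → Q → ℂ)
    (he : ∀ p, Continuous fun μ => e μ p) (ε : ℝ)
    (hfin : ∀ μ, ∃ i, {p | p ∉ P i ∧ ε < ‖e μ p‖}.Finite) :
    ∃ i, ∃ S : Set Q, S.Finite ∧ ∃ W : Set (J → Metric.closedBall (0 : ℂ) 1), IsOpen W ∧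
      W.Nonempty ∧ ∀ μ ∈ W, ∀ p, p ∉ P i → p ∉ S → ‖e μ p‖ ≤ ε := by
  let B : ι → (J → Metric.closedBall (0 : ℂ) 1) → Set Q := fun i μ => {p | p ∉ P i ∧ ε < ‖e μ p‖}
  have hopen : ∀ S : Set Q, S.Finite → IsOpen {μ | ∀ p ∈ S, ε < ‖e μ p‖} := by
    intro S hS
    have : {μ | ∀ p ∈ S, ε < ‖e μ p‖} = ⋂ p ∈ S, {μ | ε < ‖e μ p‖} := by ext; simp
    rw [this]
    exact hS.isOpen_biInter fun p _ => isOpen_lt continuous_const (he p).norm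
  let A : ι × ULift.{v} ℕ → Set (J → Metric.closedBall (0 : ℂ) 1) :=
    fun q => {μ | (B q.1 μ).encard ≤ q.2.down}
  have hA : ∀ q, IsClosed (A q) := by
    rintro ⟨i, ⟨n⟩⟩
    rw [← isOpen_compl_iff, isOpen_iff_mem_nhds]
    -- Having more than `n` exceptional points is witnessed by `n + 1` strict inequalities, which
    -- persist near `μ`.
    intro μ hμ
    have hμ' : (n : ℕ∞) < (B i μ).encard := not_le.mp hμ
    obtain ⟨S, hS, hcard⟩ := exists_subset_encard_eq (Order.add_one_le_of_lt hμ')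
    have hSfin : S.Finite := finite_of_encard_eq_coe (k := n + 1) (by rw [hcard]; rfl)
    refine mem_of_superset ((hopen S hSfin).mem_nhds fun p hp => (hS hp).2) fun ν hν => ?_
    have hsub : S ⊆ B i ν := fun p hp => ⟨(hS hp).1, hν p hp⟩
    refine not_le.mpr (lt_of_lt_of_le ?_ (encard_le_encard hsub))
    rw [hcard]
    exact_mod_cast Nat.lt_succ_self n
  have hcov : ⋃ q, A q = univ := by
    refine eq_univ_of_forall fun μ => ?_
    obtain ⟨i, hi⟩ := hfin μ
    exact mem_iUnion.mpr ⟨(i, ⟨(B i μ).ncard⟩), (hi.cast_ncard_eq).ge⟩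
  have hcard : Cardinal.mk (ι × ULift.{v} ℕ) ≤ max Cardinal.aleph0 κ := by
    rw [Cardinal.mk_prod, Cardinal.lift_id, Cardinal.lift_id]
    refine (Cardinal.mul_le_max _ _).trans (max_le (max_le hι ?_) (le_max_left _ _))
    simp
  obtain ⟨⟨i, ⟨n⟩⟩, hne⟩ := exists_nonempty_interior_of_lt_covDisc hκ hcard A hA hcov
  have hmem : ∀ μ ∈ interior (A (i, ⟨n⟩)), (B i μ).Finite ∧ (B i μ).ncard ≤ n := by
    intro μ hμ
    have h : (B i μ).encard ≤ n := interior_subset (s := A (i, ⟨n⟩)) hμ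
    have hf := finite_of_encard_le_coe h
    rw [← hf.cast_ncard_eq] at h
    exact ⟨hf, by exact_mod_cast h⟩
  -- The exceptional points of `μ₀` stay exceptional nearby; if their number is maximal, no new ones
  -- can appear, so the exceptional set is locally constant.
  obtain ⟨μ₀, hμ₀, hmax⟩ : ∃ μ₀ ∈ interior (A (i, ⟨n⟩)), ∀ μ ∈ interior (A (i, ⟨n⟩)),
      (B i μ).ncard ≤ (B i μ₀).ncard := by
    have hbdd : ((fun μ => (B i μ).ncard) '' interior (A (i, ⟨n⟩))).Finite := by
      refine (finite_Iic n).subset ?_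
      rintro _ ⟨μ, hμ, rfl⟩
      exact (hmem μ hμ).2
    obtain ⟨_, ⟨μ₀, hμ₀, rfl⟩, h⟩ := hbdd.exists_maximal (hne.image _)
    refine ⟨μ₀, hμ₀, fun μ hμ => ?_⟩
    rcases le_total (B i μ).ncard (B i μ₀).ncard with h' | h'
    exacts [h', h ⟨μ, hμ, rfl⟩ h']
  refine ⟨i, B i μ₀, (hmem μ₀ hμ₀).1, interior (A (i, ⟨n⟩)) ∩ {μ | ∀ p ∈ B i μ₀, ε < ‖e μ p‖},
    isOpen_interior.inter (hopen _ (hmem μ₀ hμ₀).1), ⟨μ₀, hμ₀, fun p hp => hp.2⟩, ?_⟩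
  rintro μ ⟨hμ, hμ'⟩ p hpP hpS
  have hsub : B i μ₀ ⊆ B i μ := fun q hq => ⟨hq.1, hμ' q hq⟩
  have heq := eq_of_subset_of_ncard_le hsub (hmax μ hμ) (hmem μ hμ).1
  by_contra! hlt
  exact hpS (heq ▸ ⟨hpP, hlt⟩)

/-- Numbering each fiber embeds `X` into `Y × ℕ`, which has the cardinality of the infinite set `Y`.
-/
theorem exists_injective_of_finite_fibers {X : Type u} {Y : Type v} [Infinite X] (f : X → Y)
    (hf : ∀ y, {x | f x = y}.Finite) : ∃ h : X → Y, Function.Injective h := by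
  have : Infinite Y := by
    by_contra hY
    rw [not_infinite_iff_finite] at hY
    exact infinite_univ (α := X)
      (((finite_univ (α := Y)).biUnion fun y _ => hf y).subset fun x _ =>
        mem_biUnion (mem_univ (f x)) rfl)
  have key : ∀ y, ∃ g : X → ℕ, InjOn g {x | f x = y} := fun y => countable_iff_exists_injOn.mp (hf y).countable
  choose g hg using key
  have hcard : Cardinal.mk (Y × ULift.{v} ℕ) = Cardinal.mk Y := by
    rw [Cardinal.mk_prod, Cardinal.lift_id, Cardinal.lift_id]
    simp
  obtain ⟨e⟩ := Cardinal.eq.mp hcard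
  refine ⟨fun x => e (f x, ⟨g (f x) x⟩), fun x x' hxx' => ?_⟩
  have h := e.injective hxx'
  rw [Prod.mk.injEq, ULift.up.injEq] at h
  refine hg (f x') h.1 rfl ?_
  rw [← h.2, h.1]

/-! ### Weighted composition operators on `ℓ₂` -/

/-- Each coefficient of `η` is counted at most `N` times; hence composition with `φ` has norm at
most `√N`. -/
theorem sum_norm_sq_comp_le {X : Type u} (φ : X → X) {N : ℕ}
    (hφ : ∀ z, {x | φ x = z}.encard ≤ N) (η : EllTwo X) (s : Finset X) :
    ∑ x ∈ s, ‖η (φ x)‖ ^ 2 ≤ N * ‖η‖ ^ 2 := by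
  classical
  have hcard : ∀ z, (s.filter fun x => φ x = z).card ≤ N := by
    intro z
    have h : ((s.filter fun x => φ x = z : Finset X) : Set X).encard ≤ N :=
      (encard_le_encard fun x hx => (Finset.mem_filter.mp hx).2).trans (hφ z)
    rw [encard_coe_eq_coe_finsetCard] at h
    exact_mod_cast h
  have hη : ∑ z ∈ s.image φ, ‖η z‖ ^ 2 ≤ ‖η‖ ^ 2 := by
    have := lp.sum_rpow_le_norm_rpow (p := 2) (by simp) η (s.image φ)
    simpa using this
  calc ∑ x ∈ s, ‖η (φ x)‖ ^ 2
      = ∑ z ∈ s.image φ, (s.filter fun x => φ x = z).card • ‖η z‖ ^ 2 :=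
        Finset.sum_comp (fun z => ‖η z‖ ^ 2) φ
    _ ≤ ∑ z ∈ s.image φ, N * ‖η z‖ ^ 2 := by
        refine Finset.sum_le_sum fun z _ => ?_
        rw [nsmul_eq_mul]
        gcongr
        exact hcard z
    _ ≤ N * ‖η‖ ^ 2 := by
        rw [← Finset.mul_sum]
        gcongr

theorem exists_weightedComp {X : Type u} (φ : X → X) {N : ℕ}
    (hφ : ∀ z, {x | φ x = z}.encard ≤ N) (w : X → ℂ) (hw : ∀ x, ‖w x‖ ≤ 1) :
    ∃ S : EllTwo X →L[ℂ] EllTwo X, ∀ η x, S η x = w x * η (φ x) := by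
  have hsum : ∀ (η : EllTwo X) (s : Finset X),
      ∑ x ∈ s, ‖w x * η (φ x)‖ ^ (2 : ℝ≥0∞).toReal ≤ N * ‖η‖ ^ 2 := by
    intro η s
    refine le_trans (Finset.sum_le_sum fun x _ => ?_) (sum_norm_sq_comp_le φ hφ η s)
    rw [ENNReal.toReal_ofNat, Real.rpow_two, norm_mul]
    gcongr
    exact mul_le_of_le_one_left (norm_nonneg _) (hw x)
  let T : EllTwo X →ₗ[ℂ] EllTwo X :=
    { toFun := fun η => ⟨fun x => w x * η (φ x), memℓp_gen' (hsum η)⟩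
      map_add' := fun η ξ => by
        ext x
        exact mul_add _ _ _
      map_smul' := fun c η => by
        ext x
        exact mul_left_comm _ _ _ }
  refine ⟨T.mkContinuous (Real.sqrt N) fun η => ?_, fun η x => rfl⟩
  refine lp.norm_le_of_forall_sum_le (by simp) (by positivity) fun s => (hsum η s).trans ?_
  rw [ENNReal.toReal_ofNat, Real.rpow_two, mul_pow, Real.sq_sqrt (Nat.cast_nonneg _)]

theorem delta_apply_of_ne {X : Type u} {x z : X} (h : z ≠ x) : delta z x = 0 := by
  simp [delta, lp.single_apply, h.symm]

theorem norm_delta {X : Type u} (x : X) : ‖delta x‖ = 1 := by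
  classical
  simp [delta, lp.norm_single]

theorem norm_inner_delta_le {X : Type u} (T : EllTwo X →L[ℂ] EllTwo X) (x x' : X) :
    ‖(inner ℂ (T (delta x)) (delta x') : ℂ)‖ ≤ ‖T‖ := by
  refine (norm_inner_le_norm _ _).trans ?_
  rw [norm_delta, mul_one]
  simpa [norm_delta] using T.le_opNorm (delta x)

namespace CoarseStructure

variable {X : Type u} {Y : Type v}

theorem weightedComp_mem_algRoe {𝓔 : CoarseStructure X} {φ : X → X}
    (hE : {p : X × X | p.1 = φ p.2} ∈ 𝓔.entourages) {w : X → ℂ} {S : EllTwo X →L[ℂ] EllTwo X}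
    (hS : ∀ η x, S η x = w x * η (φ x)) : S ∈ 𝓔.algRoe := by
  refine ⟨_, hE, fun z x hzx => ?_⟩
  have hzx' : z ≠ φ x := hzx
  rw [← inner_conj_symm, inner_delta_left, hS, delta_apply_of_ne hzx']
  simp

/-- Matrix entries of an operator in the uniform Roe algebra are small off some entourage. -/
theorem exists_entry_le_of_mem_uniformRoe {𝓔 : CoarseStructure X}
    {T : EllTwo X →L[ℂ] EllTwo X} (hT : T ∈ 𝓔.uniformRoe) {ε : ℝ} (hε : 0 < ε) :
    ∃ E ∈ 𝓔.entourages, ∀ x x' : X, (x, x') ∉ E →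
      ‖(inner ℂ (T (delta x)) (delta x') : ℂ)‖ ≤ ε := by
  have hT' : T ∈ closure (𝓔.algRoe : Set (EllTwo X →L[ℂ] EllTwo X)) := hT
  obtain ⟨S, ⟨E, hE, hS⟩, hTS⟩ := Metric.mem_closure_iff.mp hT' ε hε
  refine ⟨E, hE, fun x x' hx => ?_⟩
  have h := norm_inner_delta_le (T - S) x x'
  rw [sub_apply, inner_sub_left, hS x x' hx, sub_zero] at h
  rw [dist_eq_norm] at hTS
  exact h.trans hTS.le

theorem algRoe_le_uniformRoe (𝓔 : CoarseStructure X) : 𝓔.algRoe ≤ 𝓔.uniformRoe :=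
  StarSubalgebra.le_topologicalClosure _

end CoarseStructure

/-! ### Matrix entries as functions of the weights -/

theorem summable_norm_inner {X : Type u} (a b : EllTwo X) :
    Summable fun x => ‖(inner ℂ (a x) (b x) : ℂ)‖ := by
  have h : Summable fun x => (inner ℂ (a x) (b x) : ℂ) :=
    lp.summable_inner (𝕜 := ℂ) (G := fun _ : X => ℂ) a b
  exact h.norm

/-- As weights have modulus at most one, the series is dominated by a summable one independent of
`μ`. -/
theorem continuous_tsum_weight {X : Type u} {Y : Type v} (h : X → Y) (a b : EllTwo X) :
    Continuous fun μ : Y → Metric.closedBall (0 : ℂ) 1 =>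
      ∑' x, (inner ℂ ((μ (h x) : ℂ) * a x) (b x) : ℂ) := by
  refine continuous_tsum (u := fun x => ‖(inner ℂ (a x) (b x) : ℂ)‖) (fun x => ?_)
    (summable_norm_inner a b) fun x μ => ?_
  · have : Continuous fun μ : Y → Metric.closedBall (0 : ℂ) 1 => (μ (h x) : ℂ) :=
      continuous_subtype_val.comp (continuous_apply (h x))
    fun_prop
  · have hμ : ‖(μ (h x) : ℂ)‖ ≤ 1 := mem_closedBall_zero_iff.mp (μ (h x)).2
    rw [← smul_eq_mul, inner_smul_left, norm_mul, RCLike.norm_conj]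
    exact mul_le_of_le_one_left (norm_nonneg _) hμ

theorem summable_weight {X : Type u} {Y : Type v} (h : X → Y) (a b : EllTwo X)
    (μ : Y → Metric.closedBall (0 : ℂ) 1) :
    Summable fun x => (inner ℂ ((μ (h x) : ℂ) * a x) (b x) : ℂ) := by
  refine Summable.of_norm_bounded (summable_norm_inner a b) fun x => ?_
  have hμ : ‖(μ (h x) : ℂ)‖ ≤ 1 := mem_closedBall_zero_iff.mp (μ (h x)).2
  rw [← smul_eq_mul, inner_smul_left, norm_mul, RCLike.norm_conj]
  exact mul_le_of_le_one_left (norm_nonneg _) hμ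

theorem tsum_weight_update_sub {X : Type u} {Y : Type v} [DecidableEq Y] {h : X → Y}
    (hh : Function.Injective h) (a b : EllTwo X) (μ : Y → Metric.closedBall (0 : ℂ) 1) (x : X)
    (c d : Metric.closedBall (0 : ℂ) 1) :
    (∑' z, (inner ℂ ((Function.update μ (h x) c (h z) : ℂ) * a z) (b z) : ℂ))
      - ∑' z, (inner ℂ ((Function.update μ (h x) d (h z) : ℂ) * a z) (b z) : ℂ)
      = inner ℂ (((c : ℂ) - d) * a x) (b x) := by
  rw [← (summable_weight h a b _).tsum_sub (summable_weight h a b _), tsum_eq_single x]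
  · rw [Function.update_self, Function.update_self, sub_mul, inner_sub_left]
  · intro z hz
    rw [Function.update_of_ne (hh.ne hz), Function.update_of_ne (hh.ne hz), sub_self]

/-- Changing one weight detects a single product of coefficients. -/
theorem norm_mul_norm_le_of_update {X : Type u} {Y : Type v} [DecidableEq Y] {h : X → Y}
    (hh : Function.Injective h) (a b : EllTwo X) (x : X) {W : Set (Y → Metric.closedBall (0 : ℂ) 1)}
    {μ : Y → Metric.closedBall (0 : ℂ) 1} (hμ : ∀ c, Function.update μ (h x) c ∈ W) {ε : ℝ}
    (hW : ∀ ν ∈ W, ‖∑' z, (inner ℂ ((ν (h z) : ℂ) * a z) (b z) : ℂ)‖ ≤ ε) :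
    ‖a x‖ * ‖b x‖ ≤ ε := by
  -- The points `1` and `-1` are at distance `2`, which absorbs the `2ε` of the triangle inequality.
  let c₁ : Metric.closedBall (0 : ℂ) 1 := ⟨1, by simp⟩
  let c₂ : Metric.closedBall (0 : ℂ) 1 := ⟨-1, by simp⟩
  have hsub := tsum_weight_update_sub hh a b μ x c₁ c₂
  have hval : ‖(inner ℂ (((c₁ : ℂ) - c₂) * a x) (b x) : ℂ)‖ = 2 * (‖a x‖ * ‖b x‖) := by
    rw [← smul_eq_mul, inner_smul_left, norm_mul, RCLike.norm_conj]
    have : ‖(c₁ : ℂ) - c₂‖ = 2 := by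
      change ‖(1 : ℂ) - -1‖ = 2
      norm_num
    rw [this, RCLike.inner_apply, norm_mul, RCLike.norm_conj, mul_comm ‖b x‖]
  have h₀ : 2 * (‖a x‖ * ‖b x‖) ≤ ε + ε := by
    rw [← hval, ← hsub]
    exact (norm_sub_le _ _).trans (add_le_add (hW _ (hμ c₁)) (hW _ (hμ c₂)))
  linarith

/-! ### Transport of entourages along a family of vectors -/

namespace CoarseStructure

variable {X : Type u} {Y : Type v}

/-- The relation on `Y` of pairs `(y, y')` for which `b y` and `b y'` have large coefficients at
some points related by `E`. -/
def transport (b : Y → EllTwo X) (δ : ℝ) (E : SetRel X X) : SetRel Y Y :=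
  {p | ∃ x x', (x, x') ∈ E ∧ δ ≤ ‖b p.1 x‖ * ‖b p.2 x'‖}

section

variable {𝓔 : CoarseStructure X} {𝓕 : CoarseStructure Y} {b : Y → EllTwo X}

theorem mem_transport_graph {φ : X → X} {δ : ℝ} {p : Y × Y}
    (hp : p ∈ transport b δ {p : X × X | p.1 = φ p.2}) :
    ∃ x, δ ≤ ‖b p.1 (φ x)‖ * ‖b p.2 x‖ := by
  obtain ⟨z, x, hz, hp⟩ := hp
  have hz' : z = φ x := hz
  exact ⟨x, hz' ▸ hp⟩

theorem norm_coeff_le_one (hb : ∀ y, ‖b y‖ ≤ 1) (y : Y) (x : X) : ‖b y x‖ ≤ 1 :=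
  (lp.norm_apply_le_norm (by simp) (b y) x).trans (hb y)

theorem finite_large_pairs (hb : ∀ y, ‖b y‖ ≤ 1)
    (hcol : ∀ x, ∀ δ > 0, {y | δ ≤ ‖b y x‖}.Finite) {δ : ℝ} (hδ : 0 < δ) (x x' : X) :
    {p : Y × Y | δ ≤ ‖b p.1 x‖ * ‖b p.2 x'‖}.Finite := by
  refine ((hcol x δ hδ).prod (hcol x' δ hδ)).subset fun p hp => ⟨?_, ?_⟩
  · exact le_trans hp (mul_le_of_le_one_right (norm_nonneg _) (norm_coeff_le_one hb _ _))
  · exact le_trans hp (mul_le_of_le_one_left (norm_nonneg _) (norm_coeff_le_one hb _ _))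

/-- The weighted composition operators along `φ`, together with the formula for their entries. -/
theorem exists_weighted_family (h𝓔 : 𝓔.UniformlyLocallyFinite) {φ : X → X}
    (hφ : {p : X × X | p.1 = φ p.2} ∈ 𝓔.entourages) {J : Type*} (h : X → J) (b : Y → EllTwo X) :
    ∃ (a : Y → EllTwo X) (S : (J → Metric.closedBall (0 : ℂ) 1) → EllTwo X →L[ℂ] EllTwo X),
      (∀ y x, a y x = b y (φ x)) ∧ (∀ μ, S μ ∈ 𝓔.algRoe) ∧ ∀ μ y y',
        (inner ℂ (S μ (b y)) (b y') : ℂ)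
          = ∑' x, (inner ℂ ((μ (h x) : ℂ) * a y x) (b y' x) : ℂ) := by
  obtain ⟨N, hN⟩ := h𝓔.exists_bound hφ
  have hfib : ∀ z, {x | φ x = z}.encard ≤ N := fun z => by
    simpa only [mem_ofPred_eq, eq_comm] using hN z
  choose S hS using fun μ : J → Metric.closedBall (0 : ℂ) 1 =>
    exists_weightedComp φ hfib (fun x => (μ (h x) : ℂ))
      fun x => mem_closedBall_zero_iff.mp (μ (h x)).2
  obtain ⟨V, hV⟩ := exists_weightedComp φ hfib (fun _ => 1) (by simp)
  have hVb : ∀ y x, V (b y) x = b y (φ x) := fun y x => by rw [hV, one_mul]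
  refine ⟨fun y => V (b y), S, hVb, fun μ => weightedComp_mem_algRoe hφ (hS μ), fun μ y y' => ?_⟩
  simp only [lp.inner_eq_tsum, hS, hVb]

/-- If `p` lay in no entourage, the entry at `p` would be at most `δ / 2` for every weight, and
changing the weight at `x` would contradict the lower bound `δ`. This supplies the pointwise
hypothesis of `finite_mem`. -/
theorem exists_mem_of_mem_transport_graph (h𝓔 : 𝓔.UniformlyLocallyFinite)
    (hroe : ∀ S ∈ 𝓔.algRoe, ∀ ε > 0, ∃ F ∈ 𝓕.entourages, ∀ y y', (y, y') ∉ F →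
      ‖(inner ℂ (S (b y)) (b y') : ℂ)‖ ≤ ε)
    {φ : X → X} (hφ : {p : X × X | p.1 = φ p.2} ∈ 𝓔.entourages) {δ : ℝ} (hδ : 0 < δ)
    {p : Y × Y} (hp : p ∈ transport b δ {p : X × X | p.1 = φ p.2}) :
    ∃ F ∈ 𝓕.entourages, p ∈ F := by
  classical
  obtain ⟨x, hp⟩ := mem_transport_graph hp
  obtain ⟨a, S, ha, hS, he⟩ := exists_weighted_family h𝓔 hφ id b
  by_contra! hn
  have := norm_mul_norm_le_of_update Function.injective_id (a p.1) (b p.2) x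
    (W := univ) (μ := fun _ => ⟨0, by simp⟩) (fun _ => mem_univ _) (ε := δ / 2) fun ν _ => by
      rw [← he]
      obtain ⟨F, hF, h⟩ := hroe _ (hS ν) (δ / 2) (by positivity)
      exact h _ _ (hn F hF)
  rw [ha] at this
  linarith

/-- The relation is contained in one word together with finitely many pairs: those in the
exceptional set `K`, and those caused by the finitely many `x` whose weight the open set `W`
constrains. -/
theorem transport_graph_mem (h𝓔 : 𝓔.UniformlyLocallyFinite) (h𝓕 : 𝓕.UniformlyLocallyFinite)
    (hY : 𝓕.AdmitsSmallPartition) (hb : ∀ y, ‖b y‖ ≤ 1)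
    (hcol : ∀ x, ∀ δ > 0, {y | δ ≤ ‖b y x‖}.Finite)
    (hroe : ∀ S ∈ 𝓔.algRoe, ∀ ε > 0, ∃ F ∈ 𝓕.entourages, ∀ y y', (y, y') ∉ F →
      ‖(inner ℂ (S (b y)) (b y') : ℂ)‖ ≤ ε)
    (hinj : Infinite X → ∃ h : X → Y, Function.Injective h) {φ : X → X}
    (hφ : {p : X × X | p.1 = φ p.2} ∈ 𝓔.entourages) {δ : ℝ} (hδ : 0 < δ) :
    transport b δ {p : X × X | p.1 = φ p.2} ∈ 𝓕.entourages := by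
  classical
  have hpoint : ∀ p ∈ transport b δ {p : X × X | p.1 = φ p.2}, ∃ F ∈ 𝓕.entourages, p ∈ F :=
    fun p hp => exists_mem_of_mem_transport_graph h𝓔 hroe hφ hδ hp
  rcases finite_or_infinite X with hX | hX
  -- For finite `X` the relation is finite, so no injection into `Y` is needed.
  · refine 𝓕.finite_mem ((finite_iUnion fun x =>
      finite_large_pairs hb hcol hδ (φ x) x).subset ?_) hpoint
    intro p hp
    obtain ⟨x, hp⟩ := mem_transport_graph hp
    exact mem_iUnion.mpr ⟨x, hp⟩
  obtain ⟨h, hh⟩ := hinj hX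
  obtain ⟨a, S, ha, hS, he⟩ := exists_weighted_family h𝓔 hφ h b
  obtain ⟨r, hsmall, hgen⟩ := hY
  obtain ⟨G, hG, hGcard⟩ := exists_generate_eq_mk_eq_minGenerators (𝓕.blockDiagonal r)
  have hι : Cardinal.mk (List G) ≤ max Cardinal.aleph0 (𝓕.blockDiagonal r).minGenerators :=
    hGcard ▸ Cardinal.mk_list_le_max G
  have hword : ∀ l : List G, word (l.map Subtype.val) ∈ 𝓕.entourages := fun l => by
    refine mem_of_mem_blockDiagonal (r := r) (word_mem _ _ fun g hg => ?_)
    obtain ⟨g', -, rfl⟩ := List.mem_map.mp hg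
    exact hG.subst (motive := fun 𝓑 => g'.1 ∈ 𝓑.entourages) (subset_generate G g'.2)
  -- The threshold `δ / 2` is strictly below the lower bound `δ` in `transport`, which gives the
  -- final contradiction.
  obtain ⟨l, K, hK, W, hWo, ⟨μ, hμ⟩, hW⟩ := exists_isOpen_forall_norm_le hsmall hι
    (fun l : List G => word (l.map Subtype.val))
    (fun μ p => ∑' x, (inner ℂ ((μ (h x) : ℂ) * a p.1 x) (b p.2 x) : ℂ))
    (fun p => continuous_tsum_weight h _ _) (δ / 2) (by
      intro μ
      obtain ⟨F, hF, hFe⟩ := hroe _ (hS μ) (δ / 2) (by positivity)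
      obtain ⟨D, hD, hfin⟩ := exists_blockDiagonal_finite_diff h𝓕 hgen hF
      rw [← hG] at hD
      obtain ⟨l, hl⟩ := exists_subset_word hD
      refine ⟨l, hfin.subset fun p hp => ⟨?_, fun h => hp.1 (hl h)⟩⟩
      by_contra hn
      have := hFe p.1 p.2 hn
      rw [he] at this
      exact absurd this (not_le.mpr hp.2))
  obtain ⟨I, t, ht, hIW⟩ := isOpen_pi_iff.mp hWo μ hμ
  -- A basic neighbourhood of `μ` constrains only the coordinates in the finite set `I`.
  have hupd : ∀ x, h x ∉ I → ∀ c, Function.update μ (h x) c ∈ W := by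
    refine fun x hx c => hIW fun y hy => ?_
    rw [Function.update_of_ne (fun hyx : y = h x => hx (hyx ▸ hy))]
    exact (ht y hy).2
  have hI : (h ⁻¹' I).Finite := I.finite_toSet.preimage hh.injOn
  refine 𝓕.subset_mem _ _ (𝓕.union_mem _ _ (hword l) (𝓕.finite_mem
    (K := transport b δ {p : X × X | p.1 = φ p.2} \ word (l.map Subtype.val))
    ((hK.union (hI.biUnion fun x _ => finite_large_pairs hb hcol hδ (φ x) x)).subset ?_)
    fun p hp => hpoint p hp.1)) fun p hp => ?_
  · rintro p ⟨hp, hpl⟩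
    obtain ⟨x, hp⟩ := mem_transport_graph hp
    by_cases hpK : p ∈ K
    · exact Or.inl hpK
    · refine Or.inr (mem_biUnion (x := x) ?_ hp)
      by_contra hx
      have := norm_mul_norm_le_of_update hh (a p.1) (b p.2) x (hupd x hx)
        fun ν hν => hW ν hν p hpl hpK
      rw [ha] at this
      linarith
  · by_cases hpl : p ∈ word (l.map Subtype.val)
    · exact Or.inl hpl
    · exact Or.inr ⟨hp, hpl⟩

end

end CoarseStructure

namespace CoarseStructure

variable {X : Type u} {Y : Type v}

section

variable {𝓔 : CoarseStructure X} {𝓕 : CoarseStructure Y} {b : Y → EllTwo X}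

theorem transport_mem (h𝓔 : 𝓔.UniformlyLocallyFinite) (h𝓕 : 𝓕.UniformlyLocallyFinite)
    (hY : 𝓕.AdmitsSmallPartition) (hb : ∀ y, ‖b y‖ ≤ 1)
    (hcol : ∀ x, ∀ δ > 0, {y | δ ≤ ‖b y x‖}.Finite)
    (hroe : ∀ S ∈ 𝓔.algRoe, ∀ ε > 0, ∃ F ∈ 𝓕.entourages, ∀ y y', (y, y') ∉ F →
      ‖(inner ℂ (S (b y)) (b y') : ℂ)‖ ≤ ε)
    (hinj : Infinite X → ∃ h : X → Y, Function.Injective h) {E : SetRel X X} (hE : E ∈ 𝓔.entourages)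
    {δ : ℝ} (hδ : 0 < δ) : transport b δ E ∈ 𝓕.entourages := by
  -- The graphs express the first coordinate through the second, so selections are taken from
  -- `E.inv`; the diagonal makes it reflexive.
  have hE' : E.inv ∪ {p | p.1 = p.2} ∈ 𝓔.entourages :=
    𝓔.union_mem _ _ (𝓔.inv_mem _ hE) 𝓔.diag_mem
  obtain ⟨N, hN⟩ := h𝓔.exists_bound hE'
  obtain ⟨φ, hφE, hφ⟩ := exists_selections (fun x => Or.inr rfl) hN
  have hgraph : ∀ i, {p : X × X | p.1 = φ i p.2} ∈ 𝓔.entourages := fun i => by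
    refine 𝓔.subset_mem _ _ (𝓔.inv_mem _ hE') ?_
    rintro ⟨z, x⟩ (hz : z = φ i x)
    exact hz ▸ hφE i x
  have hunion : ∀ s : Finset (Fin N),
      (⋃ i ∈ s, transport b δ {p : X × X | p.1 = φ i p.2} : Set (Y × Y)) ∈ 𝓕.entourages := by
    classical
    intro s
    induction s using Finset.induction_on with
    | empty => exact 𝓕.subset_mem _ _ 𝓕.diag_mem (by simp)
    | insert i s _ ih =>
      rw [Finset.set_biUnion_insert]
      exact 𝓕.union_mem _ _
        (transport_graph_mem h𝓔 h𝓕 hY hb hcol hroe hinj (hgraph i) hδ) ih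
  refine 𝓕.subset_mem _ _ (hunion Finset.univ) ?_
  rintro p ⟨x, x', hx, hp⟩
  obtain ⟨i, hi⟩ := hφ x' x (Or.inl hx)
  exact mem_biUnion (Finset.mem_coe.mpr (Finset.mem_univ i)) ⟨x, x', hi.symm, hp⟩

end

/-! ### Entries of unitaries and conjugation of Roe algebras -/

section Unitary

variable (U : EllTwo X ≃ₗᵢ[ℂ] EllTwo Y)

theorem norm_symm_delta_apply (x : X) (y : Y) :
    ‖U.symm (delta y) x‖ = ‖U (delta x) y‖ := by
  rw [← inner_delta_left, ← inner_delta_left, ← U.inner_map_map, U.apply_symm_apply,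
    norm_inner_symm]

theorem finite_norm_apply_ge (ξ : EllTwo X) {δ : ℝ} (hδ : 0 < δ) : {x | δ ≤ ‖ξ x‖}.Finite := by
  have h : Summable fun x => ‖ξ x‖ ^ (2 : ℝ) := by
    simpa using (lp.memℓp ξ).summable (by simp)
  have := h.tendsto_cofinite_zero.eventually (gt_mem_nhds (show (0 : ℝ) < δ ^ (2 : ℝ) by positivity))
  rw [eventually_cofinite] at this
  refine this.subset fun x hx => not_lt.mpr ?_
  exact Real.rpow_le_rpow hδ.le hx (by norm_num)

/-- A lower bound on the columns of a unitary gives a function selecting large entries. -/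
theorem exists_large_entries (h : 0 < ⨅ x : X, ⨆ y : Y, ‖(inner ℂ (U (delta x)) (delta y) : ℂ)‖ₑ) :
    ∃ δ > 0, ∃ f : X → Y, ∀ x, δ ≤ ‖U (delta x) (f x)‖ := by
  obtain ⟨c, hc₀, hc⟩ := ENNReal.lt_iff_exists_nnreal_btwn.mp h
  have hc' : ∀ x, ∃ y, (c : ℝ) ≤ ‖U (delta x) y‖ := by
    intro x
    obtain ⟨y, hy⟩ := lt_iSup_iff.mp (hc.trans_le (iInf_le _ x))
    refine ⟨y, ?_⟩
    rw [← inner_delta_left, norm_inner_symm]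
    rw [← ofReal_norm, ← ENNReal.ofReal_coe_nnreal] at hy
    exact (ENNReal.ofReal_lt_ofReal_iff_of_nonneg c.2).mp hy |>.le
  choose f hf using hc'
  exact ⟨c, by exact_mod_cast hc₀, f, hf⟩

/-- Every `x` in the fiber of `f` over `y` is a coefficient of size at least `δ` in the `ℓ₂` vector
`U* δ_y`, so the fibers are finite. -/
theorem exists_injective_of_large_entries {δ : ℝ} (hδ : 0 < δ) {f : X → Y} [Infinite X]
    (hf : ∀ x, δ ≤ ‖U (delta x) (f x)‖) : ∃ h : X → Y, Function.Injective h := by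
  refine exists_injective_of_finite_fibers f fun y => ?_
  refine (finite_norm_apply_ge (U.symm (delta y)) hδ).subset ?_
  rintro x rfl
  exact (hf x).trans_eq (norm_symm_delta_apply U x (f x)).symm

/-- Unitaries that conjugate one uniform Roe algebra into another transport entourages. -/
theorem transport_unitary_mem {𝓔 : CoarseStructure X} {𝓕 : CoarseStructure Y}
    (h𝓔 : 𝓔.UniformlyLocallyFinite) (h𝓕 : 𝓕.UniformlyLocallyFinite)
    (hY : 𝓕.AdmitsSmallPartition)
    (hconj : ∀ T ∈ 𝓔.uniformRoe, ∃ T' ∈ 𝓕.uniformRoe, ∀ η, T' η = U (T (U.symm η)))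
    {δ₀ : ℝ} (hδ₀ : 0 < δ₀) {f : X → Y} (hf : ∀ x, δ₀ ≤ ‖U (delta x) (f x)‖)
    {E : SetRel X X} (hE : E ∈ 𝓔.entourages) {δ : ℝ} (hδ : 0 < δ) :
    transport (fun y => U.symm (delta y)) δ E ∈ 𝓕.entourages := by
  refine transport_mem h𝓔 h𝓕 hY ?_ ?_ ?_
    (fun _ => exists_injective_of_large_entries U hδ₀ hf) hE hδ
  · simp [norm_delta]
  · intro x δ hδ
    simpa only [norm_symm_delta_apply] using finite_norm_apply_ge (U (delta x)) hδ
  · intro S hS ε hε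
    obtain ⟨T', hT', hT⟩ := hconj S (𝓔.algRoe_le_uniformRoe hS)
    obtain ⟨F, hF, h⟩ := exists_entry_le_of_mem_uniformRoe hT' hε
    refine ⟨F, hF, fun y y' hy => ?_⟩
    have := h y y' hy
    rwa [hT, ← U.symm.inner_map_map, U.symm_apply_apply] at this

end Unitary

end CoarseStructure

/-! ### The coarse equivalence -/

theorem mainTheorem7 {X : Type u} {Y : Type v} (𝓔 : CoarseStructure X) (𝓕 : CoarseStructure Y)
    (h𝓔 : 𝓔.UniformlyLocallyFinite) (h𝓕 : 𝓕.UniformlyLocallyFinite)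
    (hX : 𝓔.AdmitsSmallPartition) (hY : 𝓕.AdmitsSmallPartition)
    (hrigid : 𝓔.RigidlyIsomorphic 𝓕) :
    𝓔.CoarselyEquivalent 𝓕 := by
  obtain ⟨Φ, U, hΦ, hU, hU'⟩ := hrigid
  obtain ⟨δ₁, hδ₁, f, hf⟩ := CoarseStructure.exists_large_entries U hU
  obtain ⟨δ₂, hδ₂, g, hg⟩ := CoarseStructure.exists_large_entries U.symm hU'
  have hconj : ∀ T ∈ 𝓔.uniformRoe, ∃ T' ∈ 𝓕.uniformRoe, ∀ η, T' η = U (T (U.symm η)) :=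
    fun T hT => ⟨Φ ⟨T, hT⟩, (Φ ⟨T, hT⟩).2, hΦ ⟨T, hT⟩⟩
  have hconj' : ∀ T ∈ 𝓕.uniformRoe, ∃ T' ∈ 𝓔.uniformRoe, ∀ η,
      T' η = U.symm (T (U.symm.symm η)) := by
    intro T hT
    refine ⟨Φ.symm ⟨T, hT⟩, (Φ.symm ⟨T, hT⟩).2, fun η => ?_⟩
    have h := hΦ (Φ.symm ⟨T, hT⟩) (U η)
    rw [Φ.apply_symm_apply, U.symm_apply_apply] at h
    rw [LinearIsometryEquiv.symm_symm, h, U.symm_apply_apply]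
  have hXY : ∀ E ∈ 𝓔.entourages, ∀ δ > 0,
      CoarseStructure.transport (fun y => U.symm (delta y)) δ E ∈ 𝓕.entourages :=
    fun E hE δ hδ => CoarseStructure.transport_unitary_mem U h𝓔 h𝓕 hY hconj hδ₁ hf hE hδ
  have hYX : ∀ F ∈ 𝓕.entourages, ∀ δ > 0,
      CoarseStructure.transport (fun x => U (delta x)) δ F ∈ 𝓔.entourages :=
    fun F hF δ hδ => CoarseStructure.transport_unitary_mem U.symm h𝓕 h𝓔 hX hconj' hδ₂ hg hF hδ
  have hf' : ∀ x, δ₁ ≤ ‖U.symm (delta (f x)) x‖ := fun x =>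
    (hf x).trans_eq (CoarseStructure.norm_symm_delta_apply U x (f x)).symm
  have hg' : ∀ y, δ₂ ≤ ‖U (delta (g y)) y‖ := fun y =>
    (hg y).trans_eq (CoarseStructure.norm_symm_delta_apply U (g y) y)
  refine ⟨f, ⟨fun E hE => ⟨_, hXY E hE (δ₁ * δ₁) (by positivity), fun x x' hx => ?_⟩,
    fun F hF => ⟨_, hYX F hF (δ₁ * δ₁) (by positivity), fun x x' hx hF' => hx ?_⟩⟩,
    g, fun F hF => ⟨_, hYX F hF (δ₂ * δ₂) (by positivity), fun y y' hy => ?_⟩, ?_, ?_⟩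
  · exact ⟨x, x', hx, mul_le_mul (hf' x) (hf' x') hδ₁.le (norm_nonneg _)⟩
  · exact ⟨f x, f x', hF', mul_le_mul (hf x) (hf x') hδ₁.le (norm_nonneg _)⟩
  · exact ⟨y, y', hy, mul_le_mul (hg' y) (hg' y') hδ₂.le (norm_nonneg _)⟩
  -- Both `U δ_{g (f x)}` and `U δ_x` have a large coefficient at the same point `f x`, so
  -- transporting the diagonal of `Y` relates `g (f x)` to `x`.
  · refine 𝓔.subset_mem _ _ (hYX _ 𝓕.diag_mem (δ₂ * δ₁) (by positivity)) ?_
    rintro _ ⟨x, rfl⟩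
    exact ⟨f x, f x, rfl, mul_le_mul (hg' (f x)) (hf x) hδ₁.le (norm_nonneg _)⟩
  · refine 𝓕.subset_mem _ _ (hXY _ 𝓔.diag_mem (δ₁ * δ₂) (by positivity)) ?_
    rintro _ ⟨y, rfl⟩
    exact ⟨g y, g y, rfl, mul_le_mul (hf' (g y)) (hg y) hδ₂.le (norm_nonneg _)⟩
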